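/- For $X\in M_{m,n}(\mathbb C)$ let $S_X(Y)=X\circ Y$ be entrywise (Schur) multiplication by $X$ on $M_{m,n}(\mathbb C)$, and let $\|S_X\|$ be its norm as a linear operator when $M_{m,n}(\mathbb C)$ carries the operator norm of matrices $\mathbb C^n\to\mathbb C^m$ (Euclidean norms). For a matrix $A$ with columns $A_j$ put $\|A\|_c=\max_j\|A_j\|_2$. If $X$ has rank $r$, a Schur factorization of $X$ is a pair $L\in M_{r,m}(\mathbb C)$, $R\in M_{r,n}(\mathbb C)$ with $X=L^*R$ and $\|L\|_c=\|R\|_c=\sqrt{\|S_X\|}$. Let $\mathcal Q_n$ denote the set of positive semidefinite $n\times n$ complex matrices all of whose diagonal entries equal $1$. A finite set $\{\xi_1,\dots,\xi_s\}\subset\mathbb C^k$ is called full if the only $Y\in M_k(\mathbb C)$ with $Y=PYP$ and $\langle Y\xi_j,\xi_j\rangle=0$ for all $j$ is $Y=0$, where $P$ is the orthogonal projection of $\mathbb C^k$ onto $\operatorname{span}\{\xi_1,\dots,\xi_s\}$. Theorem. Let $X\in M_{m,n}(\mathbb C)$ be an extreme point of the convex set $\{Y\in M_{m,n}(\mathbb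 C):\|S_Y\|\le 1\}$ with $\|S_X\|=1$, and let $r$ be the rank of $X$. Then: (i) For every Schur factorization $X=L^*R$, all columns of $L$ and all columns of $R$ are unit vectors. (ii) There is a factorization $X=FVG$, where $F\in M_m(\mathbb C)$ is positive semidefinite of rank $r$ with $F^2\in\mathcal Q_m$, $G\in M_n(\mathbb C)$ is positive semidefinite of rank $r$ with $G^2\in\mathcal Q_n$, and $V\in M_{m,n}(\mathbb C)$ is a partial isometry with initial space the range of $G$ and final space the range of $F$. (iii) For every Schur factorization $X=L^*R$, the set of columns $\{L_1,\dots,L_m,R_1,\dots,R_n\}$ is a full set of vectors in $\mathbb C^r$. (iv) $\operatorname{rank}X\le\sqrt{m+n}$. -/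

import Mathlib

open scoped ComplexOrder

noncomputable section

namespace SchurMult

section Norm

open scoped Matrix.Norms.L2Operator

/-- The Schur multiplier `S_X : Y ↦ X ∘ Y` (entrywise product) on `m × n` complex matrices. -/
def schurMultiplier {m n : ℕ} (X : Matrix (Fin m) (Fin n) ℂ) :
    Matrix (Fin m) (Fin n) ℂ →ₗ[ℂ] Matrix (Fin m) (Fin n) ℂ where
  toFun Y := Matrix.hadamard X Y
  map_add' Y Z := Matrix.hadamard_add X Y Z
  map_smul' c Y := Matrix.hadamard_smul X Y c

/-- The Schur multiplier norm of `X`: the norm of the linear operator `S_X` on the space of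
`m × n` matrices, where that space carries the operator norm (between Euclidean spaces). -/
def schurNorm {m n : ℕ} (X : Matrix (Fin m) (Fin n) ℂ) : ℝ :=
  ‖LinearMap.toContinuousLinearMap (schurMultiplier X)‖

end Norm

/-- The unit ball of the `m × n` Schur multipliers. -/
def schurUnitBall (m n : ℕ) : Set (Matrix (Fin m) (Fin n) ℂ) :=
  {X | schurNorm X ≤ 1}

/-- The `j`-th column of a matrix, as a vector of a Euclidean space. -/
def colVec {k n : ℕ} (X : Matrix (Fin k) (Fin n) ℂ) (j : Fin n) : EuclideanSpace ℂ (Fin k) :=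
  WithLp.toLp 2 (fun i => X i j)

/-- The column norm: the maximum of the Euclidean norms of the columns. -/
def colNorm {k n : ℕ} (X : Matrix (Fin k) (Fin n) ℂ) : ℝ :=
  ⨆ j, ‖colVec X j‖

/-- `(L, R)` is a Schur factorization of the matrix `X` of rank `r`. -/
structure IsSchurFactorization {m n r : ℕ} (X : Matrix (Fin m) (Fin n) ℂ)
    (L : Matrix (Fin r) (Fin m) ℂ) (R : Matrix (Fin r) (Fin n) ℂ) : Prop where
  rank_eq : X.rank = r
  colNorm_left : colNorm L = Real.sqrt (schurNorm X)
  colNorm_right : colNorm R = Real.sqrt (schurNorm X)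
  eq_mul : X = L.conjTranspose * R

/-- The vector functional `Y ↦ ⟨Y ξ, ξ⟩` on matrices, with the inner product linear in its
first variable; Mathlib's inner product is linear in the second one. -/
def vectorFunctional {k : ℕ} (ξ : EuclideanSpace ℂ (Fin k)) (Y : Matrix (Fin k) (Fin k) ℂ) : ℂ :=
  inner ℂ ξ (Matrix.toEuclideanLin Y ξ)

/-- The matrix of the orthogonal projection onto the linear span of `S`. -/
def spanProj {k : ℕ} (S : Set (EuclideanSpace ℂ (Fin k))) : Matrix (Fin k) (Fin k) ℂ :=
  Matrix.toEuclideanLin.symm ((Submodule.span ℂ S).starProjection :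
    EuclideanSpace ℂ (Fin k) →ₗ[ℂ] EuclideanSpace ℂ (Fin k))

/-- A set of vectors is full if the zero matrix is the only matrix `Y` with `Y = P Y P`, `P` the
projection onto the span, on which all the vector functionals of the set vanish. -/
def IsFullSet {k : ℕ} (S : Set (EuclideanSpace ℂ (Fin k))) : Prop :=
  ∀ Y : Matrix (Fin k) (Fin k) ℂ, Y = spanProj S * Y * spanProj S →
    (∀ ξ ∈ S, vectorFunctional ξ Y = 0) → Y = 0

/-- The positive `n × n` matrices whose diagonal entries are all `1`. -/
def unitDiagPos (n : ℕ) : Set (Matrix (Fin n) (Fin n) ℂ) :=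
  {A | A.PosSemidef ∧ ∀ i, A i i = 1}

/-- The range of a matrix, in Euclidean space. -/
def matRange {m n : ℕ} (A : Matrix (Fin m) (Fin n) ℂ) : Submodule ℂ (EuclideanSpace ℂ (Fin m)) :=
  LinearMap.range (Matrix.toEuclideanLin A)

/-- `V` is the matrix of a partial isometry with initial space `S` and final space `T`. -/
structure IsPartialIsometryFromOnto {m n : ℕ} (V : Matrix (Fin m) (Fin n) ℂ)
    (S : Submodule ℂ (EuclideanSpace ℂ (Fin n))) (T : Submodule ℂ (EuclideanSpace ℂ (Fin m))) :
    Prop where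
  isometric : ∀ x ∈ S, ‖Matrix.toEuclideanLin V x‖ = ‖x‖
  vanishes : ∀ x ∈ Sᗮ, Matrix.toEuclideanLin V x = 0
  map_eq : S.map (Matrix.toEuclideanLin V) = T

end SchurMult

end

/-! The unit ball of Schur multipliers consists exactly of the products `L^*R` in which all columns
of `L` and `R` have length at most 1. That such products lie in the ball is a Cauchy–Schwarz
estimate (`norm_hadamard_le`). The converse, `exists_factorization_of_schurNorm_le_one`, is a
Hahn–Banach separation from the closed cone of diagonals and corner blocks of positive matrices,
refuted by `neg_sum_le_re_pairing`. Orthogonal projections then reduce the inner dimension to the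
rank (`exists_rank_factorization`).

Extremality is used by perturbing the factors. A column shorter than 1 can be moved in two opposite
directions, which forces `X = 0` (`norm_colVec_eq_one`). With unit columns, a Hermitian `Y` for
which `L^*YL` and `R^*YR` have zero diagonal gives `L^*(1 ± tY)R` in the ball with midpoint `X`, so
`L^*YR = 0` and hence `Y = 0` (`eq_zero_of_isHermitian`). Injectivity of the map from `Y` to these
`m + n` diagonal entries is fullness, and comparing dimensions gives `r² ≤ m + n`. Polar
decompositions `L = UF`, `R = WG` turn `L^*R` into `F(U^*W)G`. -/

namespace SchurMult

/-! ### Factorizations bound the Schur norm. -/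

section Norm

open scoped Matrix.Norms.L2Operator

/-- All columns of `L` lie in the Euclidean unit ball. -/
def ColsLeOne {κ ι : Type*} [Fintype κ] (L : Matrix κ ι ℂ) : Prop :=
  ∀ i, ∑ k, ‖L k i‖ ^ 2 ≤ 1

lemma norm_colVec_sq {k n : ℕ} (L : Matrix (Fin k) (Fin n) ℂ) (i : Fin n) :
    ‖colVec L i‖ ^ 2 = ∑ l, ‖L l i‖ ^ 2 := by
  rw [EuclideanSpace.norm_sq_eq]; rfl

lemma sum_norm_sq_rows_le {κ ι : Type*} [Fintype κ] [Fintype ι] {L : Matrix κ ι ℂ}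
    (hL : ColsLeOne L) (v : EuclideanSpace ℂ ι) :
    ∑ k, ‖WithLp.toLp 2 (fun i => L k i * v i)‖ ^ 2 ≤ ‖v‖ ^ 2 := by
  simp only [EuclideanSpace.norm_sq_eq, norm_mul, mul_pow]
  rw [Finset.sum_comm]
  refine Finset.sum_le_sum fun i _ => ?_
  rw [← Finset.sum_mul]
  exact mul_le_of_le_one_left (by positivity) (hL i)

lemma l2_opNorm_le_of_forall {m n : ℕ} (A : Matrix (Fin m) (Fin n) ℂ) {c : ℝ} (hc : 0 ≤ c)
    (h : ∀ u : EuclideanSpace ℂ (Fin n), ‖Matrix.toEuclideanLin A u‖ ≤ c * ‖u‖) : ‖A‖ ≤ c := by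
  rw [Matrix.l2_opNorm_def]
  exact ContinuousLinearMap.opNorm_le_bound _ hc h

lemma norm_toEuclideanLin_le {m n : ℕ} (A : Matrix (Fin m) (Fin n) ℂ)
    (u : EuclideanSpace ℂ (Fin n)) : ‖Matrix.toEuclideanLin A u‖ ≤ ‖A‖ * ‖u‖ :=
  A.l2_opNorm_mulVec u

/-- Summing over rows, `X ∘ Y = ∑ₖ diag(conj Lₖ) Y diag(Rₖ)`. Pairing the image `v` of `u` with
itself therefore gives `∑ₖ ⟨aₖ, Y bₖ⟩`, and the column bounds make the families `a`, `b` no longer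
in `ℓ²` than `v`, `u`. -/
lemma norm_hadamard_le {κ : Type*} [Fintype κ] {m n : ℕ} {L : Matrix κ (Fin m) ℂ}
    {R : Matrix κ (Fin n) ℂ} (hL : ColsLeOne L) (hR : ColsLeOne R)
    (Y : Matrix (Fin m) (Fin n) ℂ) : ‖Matrix.hadamard (L.conjTranspose * R) Y‖ ≤ ‖Y‖ := by
  refine l2_opNorm_le_of_forall _ (norm_nonneg _) fun u => ?_
  set v := Matrix.toEuclideanLin (Matrix.hadamard (L.conjTranspose * R) Y) u with hv
  set a : κ → EuclideanSpace ℂ (Fin m) := fun k => WithLp.toLp 2 (fun i => L k i * v i) with ha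
  set b : κ → EuclideanSpace ℂ (Fin n) := fun k => WithLp.toLp 2 (fun j => R k j * u j) with hb
  have key : inner ℂ v v = ∑ k, inner ℂ (a k) (Matrix.toEuclideanLin Y (b k)) := by
    conv_lhs => rhs; rw [hv]
    simp only [PiLp.inner_apply, RCLike.inner_apply, Matrix.toLpLin_apply, Matrix.mulVec,
      dotProduct, Matrix.hadamard_apply, Matrix.mul_apply, Matrix.conjTranspose_apply, ha, hb,
      map_mul, Finset.sum_mul]
    rw [Finset.sum_comm (s := (Finset.univ : Finset κ))]
    refine Finset.sum_congr rfl fun i _ => ?_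
    rw [Finset.sum_comm]
    refine Finset.sum_congr rfl fun k _ => Finset.sum_congr rfl fun j _ => ?_
    simp only [RCLike.star_def]
    ring
  have hav : ∑ k, ‖a k‖ ^ 2 ≤ ‖v‖ ^ 2 := sum_norm_sq_rows_le hL v
  have hbu : ∑ k, ‖b k‖ ^ 2 ≤ ‖u‖ ^ 2 := sum_norm_sq_rows_le hR u
  clear_value a b v
  have hsq : ‖v‖ ^ 2 ≤ ‖Y‖ * (‖v‖ * ‖u‖) := by
    have h1 : ‖v‖ ^ 2 = ‖(inner ℂ v v : ℂ)‖ := by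
      rw [inner_self_eq_norm_sq_to_K]; simp
    rw [h1, key]
    calc _ ≤ ∑ k, ‖a k‖ * (‖Y‖ * ‖b k‖) := by
          refine (norm_sum_le _ _).trans (Finset.sum_le_sum fun k _ => ?_)
          refine (norm_inner_le_norm _ _).trans ?_
          gcongr
          exact norm_toEuclideanLin_le Y _
      _ = ‖Y‖ * ∑ k, ‖a k‖ * ‖b k‖ := by
          rw [Finset.mul_sum]; exact Finset.sum_congr rfl fun k _ => by ring
      _ ≤ ‖Y‖ * (√(∑ k, ‖a k‖ ^ 2) * √(∑ k, ‖b k‖ ^ 2)) := by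
          exact mul_le_mul_of_nonneg_left (Real.sum_mul_le_sqrt_mul_sqrt _ _ _) (norm_nonneg _)
      _ ≤ ‖Y‖ * (‖v‖ * ‖u‖) := by
          refine mul_le_mul_of_nonneg_left (mul_le_mul ?_ ?_ ?_ ?_) (norm_nonneg _)
          · exact Real.sqrt_le_iff.2 ⟨norm_nonneg _, hav⟩
          · exact Real.sqrt_le_iff.2 ⟨norm_nonneg _, hbu⟩
          · exact Real.sqrt_nonneg _
          · exact norm_nonneg _
  rcases (norm_nonneg v).eq_or_lt with h0 | h0
  · rw [← h0]; positivity
  · nlinarith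

lemma schurNorm_mul_le_one {κ : Type*} [Fintype κ] {m n : ℕ} {L : Matrix κ (Fin m) ℂ}
    {R : Matrix κ (Fin n) ℂ} (hL : ColsLeOne L) (hR : ColsLeOne R) :
    schurNorm (L.conjTranspose * R) ≤ 1 := by
  refine ContinuousLinearMap.opNorm_le_bound _ zero_le_one fun Y => ?_
  rw [one_mul]
  exact norm_hadamard_le hL hR Y

lemma norm_hadamard_le_schurNorm {m n : ℕ} (X Y : Matrix (Fin m) (Fin n) ℂ) :
    ‖Matrix.hadamard X Y‖ ≤ schurNorm X * ‖Y‖ :=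
  (LinearMap.toContinuousLinearMap (schurMultiplier X)).le_opNorm Y

end Norm

/-! ### The dual estimate for the Schur unit ball. -/

section Duality

variable {m n : ℕ}

open scoped Matrix.Norms.L2Operator in
/-- A matrix in the unit ball of Schur multipliers pairs with `b` to at least `-(∑ p + ∑ q)`
whenever `b` is dominated by the weights `p` and `q`. -/
lemma neg_sum_le_re_pairing {X : Matrix (Fin m) (Fin n) ℂ} (hX : schurNorm X ≤ 1)
    {p : Fin m → ℝ} {q : Fin n → ℝ} (hp : ∀ i, 0 < p i) (hq : ∀ j, 0 < q j)
    {b : Matrix (Fin m) (Fin n) ℂ}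
    (h : ∀ (x : Fin m → ℂ) (y : Fin n → ℂ), 0 ≤ ∑ i, p i * ‖x i‖ ^ 2 + ∑ j, q j * ‖y j‖ ^ 2 +
      (∑ i, ∑ j, b i j * (x i * star (y j))).re) :
    0 ≤ ∑ i, p i + ∑ j, q j + (∑ i, ∑ j, b i j * X i j).re := by
  -- Rescaling by the weights turns the hypothesis into a bound for the sesquilinear form of `M`,
  -- namely `‖M‖ ≤ 2`.
  set M : Matrix (Fin m) (Fin n) ℂ := Matrix.of fun i j => b i j / (√(p i) * √(q j)) with hM
  have hsp : ∀ i, (√(p i) : ℂ) ≠ 0 := fun i => by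
    exact_mod_cast (Real.sqrt_pos.2 (hp i)).ne'
  have hsq : ∀ j, (√(q j) : ℂ) ≠ 0 := fun j => by
    exact_mod_cast (Real.sqrt_pos.2 (hq j)).ne'
  have hMn : ‖M‖ ≤ 2 := by
    refine l2_opNorm_le_of_forall _ zero_le_two fun u => ?_
    set v := Matrix.toEuclideanLin M u with hv
    have hvi : ∀ i, v i = ∑ j, M i j * u j := fun i => rfl
    -- With `v = Mu` these test vectors give `‖v‖²/4 + ‖u‖² - ‖v‖²/2 ≥ 0`. The factor 1/2 minimizes
    -- `s²‖v‖² - s‖v‖²` over `s`.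
    have := h (fun i => -(star (v i)) / (2 * √(p i))) (fun j => star (u j) / √(q j))
    have e1 : ∑ i, p i * ‖-(star (v i)) / (2 * √(p i) : ℂ)‖ ^ 2 = ‖v‖ ^ 2 / 4 := by
      rw [EuclideanSpace.norm_sq_eq, Finset.sum_div]
      refine Finset.sum_congr rfl fun i _ => ?_
      have := Real.sq_sqrt (hp i).le
      have h0 := (Real.sqrt_pos.2 (hp i)).ne'
      simp only [norm_div, norm_neg, norm_star, norm_mul, Complex.norm_real, Complex.norm_ofNat,
        Real.norm_eq_abs, div_pow, mul_pow, sq_abs, this]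
      field_simp [(hp i).ne']
      norm_num
    have e2 : ∑ j, q j * ‖star (u j) / (√(q j) : ℂ)‖ ^ 2 = ‖u‖ ^ 2 := by
      rw [EuclideanSpace.norm_sq_eq]
      refine Finset.sum_congr rfl fun j _ => ?_
      have := Real.sq_sqrt (hq j).le
      simp only [norm_div, norm_star, Complex.norm_real, Real.norm_eq_abs, div_pow, sq_abs, this]
      field_simp [(hq j).ne']
    have e3 : ∑ i, ∑ j, b i j * (-(star (v i)) / (2 * √(p i)) * star (star (u j) / (√(q j) : ℂ)))
        = ((-(‖v‖ ^ 2 / 2) : ℝ) : ℂ) := by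
      rw [EuclideanSpace.norm_sq_eq, Finset.sum_div, ← Finset.sum_neg_distrib, Complex.ofReal_sum]
      refine Finset.sum_congr rfl fun i _ => ?_
      have : ((-(‖v i‖ ^ 2 / 2) : ℝ) : ℂ) = -(star (v i)) / 2 * v i := by
        have := Complex.conj_mul' (v i)
        push_cast
        rw [← this, RCLike.star_def]; ring
      rw [this]
      conv_rhs => rhs; rw [hvi i]
      rw [Finset.mul_sum]
      refine Finset.sum_congr rfl fun j _ => ?_
      have h1 := hsp i
      have h2 := hsq j
      simp only [hM, Matrix.of_apply, star_div₀, RCLike.star_def, Complex.conj_conj,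
        Complex.conj_ofReal]
      field_simp
    rw [e1, e2, e3, Complex.ofReal_re] at this
    refine abs_le_of_sq_le_sq' (a := ‖v‖) ?_ (by positivity) |>.2
    nlinarith
  set N := Matrix.hadamard X M with hN
  have hNn : ‖N‖ ≤ 2 := (norm_hadamard_le_schurNorm X M).trans
    (by nlinarith [norm_nonneg M])
  -- Testing `X ∘ M` on the square roots of the weights undoes the rescaling. The constant 2 is what
  -- `2‖P‖‖Q‖ ≤ ‖P‖² + ‖Q‖²` absorbs.
  set P : EuclideanSpace ℂ (Fin m) := WithLp.toLp 2 fun i => (√(p i) : ℂ) with hP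
  set Q : EuclideanSpace ℂ (Fin n) := WithLp.toLp 2 fun j => (√(q j) : ℂ) with hQ
  have e : ∑ i, ∑ j, b i j * X i j = inner ℂ P (Matrix.toEuclideanLin N Q) := by
    simp only [PiLp.inner_apply, RCLike.inner_apply, Matrix.toLpLin_apply, Matrix.mulVec,
      dotProduct, Matrix.hadamard_apply, hN, hP, hQ, Finset.sum_mul]
    refine Finset.sum_congr rfl fun i _ => Finset.sum_congr rfl fun j _ => ?_
    have h1 := hsp i
    have h2 := hsq j
    simp only [hM, Matrix.of_apply, Complex.conj_ofReal]
    field_simp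
  have nP : ‖P‖ ^ 2 = ∑ i, p i := by
    rw [EuclideanSpace.norm_sq_eq]
    exact Finset.sum_congr rfl fun i _ => by simp [hP, Real.sq_sqrt (hp i).le]
  have nQ : ‖Q‖ ^ 2 = ∑ j, q j := by
    rw [EuclideanSpace.norm_sq_eq]
    exact Finset.sum_congr rfl fun i _ => by simp [hQ, Real.sq_sqrt (hq i).le]
  have hb : ‖(inner ℂ P (Matrix.toEuclideanLin N Q) : ℂ)‖ ≤ ‖P‖ * (2 * ‖Q‖) := by
    refine (norm_inner_le_norm _ _).trans ?_
    gcongr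
    exact (norm_toEuclideanLin_le N Q).trans (by gcongr)
  have := (abs_le.1 ((Complex.abs_re_le_norm _).trans hb)).1
  rw [e, ← nP, ← nQ]
  nlinarith [sq_nonneg (‖P‖ - ‖Q‖)]

end Duality

end SchurMult

namespace SchurMult

/-! ### Existence of factorizations, by separation from a cone of Gram data. -/

section GramCone

variable {ι : Type*} [Fintype ι]

open scoped MatrixOrder in
lemma exists_conjTranspose_mul_self [DecidableEq ι] {A : Matrix ι ι ℂ} (hA : A.PosSemidef) :
    ∃ C : Matrix ι ι ℂ, A = C.conjTranspose * C :=
  CStarAlgebra.nonneg_iff_eq_star_mul_self.1 (Matrix.nonneg_iff_posSemidef.2 hA)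

lemma conjTranspose_mul_self_apply_self {κ ι : Type*} [Fintype κ]
    (C : Matrix κ ι ℂ) (i : ι) :
    (C.conjTranspose * C) i i = ((∑ k, ‖C k i‖ ^ 2 : ℝ) : ℂ) := by
  rw [Matrix.mul_apply, Complex.ofReal_sum]
  refine Finset.sum_congr rfl fun k _ => ?_
  rw [Matrix.conjTranspose_apply, RCLike.star_def, Complex.conj_mul']
  push_cast; rfl

lemma norm_apply_le_of_posSemidef {A : Matrix ι ι ℂ} (hA : A.PosSemidef) (i j : ι) :
    ‖A i j‖ ≤ ‖A i i‖ + ‖A j j‖ := by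
  classical
  obtain ⟨C, rfl⟩ := exists_conjTranspose_mul_self hA
  have h : ∀ i, ‖(C.conjTranspose * C) i i‖ = ∑ k, ‖C k i‖ ^ 2 := fun i => by
    rw [conjTranspose_mul_self_apply_self, Complex.norm_real, Real.norm_eq_abs,
      abs_of_nonneg (by positivity)]
  rw [h, h, ← Finset.sum_add_distrib, Matrix.mul_apply]
  refine (norm_sum_le _ _).trans (Finset.sum_le_sum fun k _ => ?_)
  rw [norm_mul, Matrix.conjTranspose_apply, norm_star]
  nlinarith [sq_nonneg (‖C k i‖ - ‖C k j‖), sq_nonneg (‖C k i‖), sq_nonneg (‖C k j‖)]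

lemma isClosed_setOf_posSemidef : IsClosed {A : Matrix ι ι ℂ | A.PosSemidef} := by
  have : {A : Matrix ι ι ℂ | A.PosSemidef} = {A | A.conjTranspose = A} ∩
      ⋂ x : ι → ℂ, {A | 0 ≤ dotProduct (star x) (A.mulVec x)} := by
    ext A
    simp [Matrix.posSemidef_iff_dotProduct_mulVec, Matrix.IsHermitian]
  rw [this]
  refine (isClosed_eq (by fun_prop) (by fun_prop)).inter (isClosed_iInter fun x => ?_)
  exact isClosed_le continuous_const (by fun_prop)

variable (m n : ℕ)

/-- The diagonal and the upper right block of a matrix with rows and columns `m + n`. -/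
def gramData : Matrix (Fin m ⊕ Fin n) (Fin m ⊕ Fin n) ℂ →ₗ[ℂ]
    (Fin m ⊕ Fin n → ℂ) × (Fin m → Fin n → ℂ) where
  toFun A := (fun s => A s s, fun i j => A (Sum.inl i) (Sum.inr j))
  map_add' _ _ := rfl
  map_smul' _ _ := rfl

/-- The diagonals and upper right blocks of the positive semidefinite matrices. -/
def gramCone : Set ((Fin m ⊕ Fin n → ℂ) × (Fin m → Fin n → ℂ)) :=
  gramData m n '' {A | A.PosSemidef}

variable {m n}

lemma convex_gramCone : Convex ℝ (gramCone m n) := by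
  rintro _ ⟨A, hA, rfl⟩ _ ⟨B, hB, rfl⟩ a b ha hb -
  refine ⟨a • A + b • B, (hA.smul ha).add (hB.smul hb), rfl⟩

/-- A linear image of a closed cone need not be closed. Here the diagonal, which the image retains,
bounds every entry of a positive matrix, so preimages of a convergent sequence have a convergent
subsequence. -/
lemma isClosed_gramCone : IsClosed (gramCone m n) := by
  refine IsSeqClosed.isClosed fun z z₀ hz hlim => ?_
  choose A hA hAz using hz
  obtain ⟨c, hc⟩ := (Metric.isBounded_range_of_tendsto z hlim).exists_norm_le
  have hdiag : ∀ k s, ‖A k s s‖ ≤ c := fun k s => by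
    have h1 := hc (z k) ⟨k, rfl⟩
    rw [← hAz k] at h1
    exact (norm_le_pi_norm (gramData m n (A k)).1 s).trans ((norm_fst_le _).trans h1)
  have hc0 : 0 ≤ c := (norm_nonneg _).trans (hc (z 0) ⟨0, rfl⟩)
  -- As plain functions the matrices carry the sup norm of a product.
  let A' : ℕ → (Fin m ⊕ Fin n) → (Fin m ⊕ Fin n) → ℂ := A
  have hbd : ∀ k, A' k ∈ Metric.closedBall 0 (c + c) := fun k => by
    rw [mem_closedBall_zero_iff, pi_norm_le_iff_of_nonneg (by positivity)]
    intro s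
    rw [pi_norm_le_iff_of_nonneg (by positivity)]
    exact fun t => (norm_apply_le_of_posSemidef (hA k) s t).trans
      (add_le_add (hdiag k s) (hdiag k t))
  obtain ⟨B, -, φ, hφ, hB⟩ := tendsto_subseq_of_bounded Metric.isBounded_closedBall hbd
  have hBpos : Matrix.PosSemidef (B : Matrix _ _ ℂ) :=
    isClosed_setOf_posSemidef.mem_of_tendsto
      (show Filter.Tendsto (fun k => A (φ k)) Filter.atTop (nhds (B : Matrix _ _ ℂ)) from hB)
      (Filter.Eventually.of_forall fun k => hA (φ k))
  refine ⟨B, hBpos, ?_⟩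
  have h1 : Filter.Tendsto (fun k => gramData m n (A (φ k))) Filter.atTop
      (nhds (gramData m n B)) :=
    ((LinearMap.continuous_of_finiteDimensional (gramData m n)).tendsto (B : Matrix _ _ ℂ)).comp hB
  have h2 : Filter.Tendsto (fun k => gramData m n (A (φ k))) Filter.atTop (nhds z₀) := by
    simp only [hAz]
    exact hlim.comp hφ.tendsto_atTop
  exact tendsto_nhds_unique h1 h2

lemma linearMap_apply_eq_sum (f : (Fin m ⊕ Fin n → ℂ) × (Fin m → Fin n → ℂ) →ₗ[ℂ] ℂ) :
    ∃ (c : Fin m ⊕ Fin n → ℂ) (b : Matrix (Fin m) (Fin n) ℂ), ∀ z,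
      f z = ∑ s, c s * z.1 s + ∑ i, ∑ j, b i j * z.2 i j := by
  classical
  refine ⟨fun s => f (Pi.single s 1, 0), fun i j => f (0, Pi.single i (Pi.single j 1)), ?_⟩
  rintro ⟨d, Z⟩
  have h1 : d = ∑ s, d s • Pi.single s (1 : ℂ) := by
    ext t; simp [Finset.sum_apply, Pi.single_apply]
  have h2 : Z = ∑ i, ∑ j, Z i j • Pi.single i (Pi.single j (1 : ℂ)) := by
    ext i j
    simp only [Finset.sum_apply, Pi.smul_apply, smul_eq_mul]
    rw [Finset.sum_eq_single i (fun k _ hk => by simp [Pi.single_eq_of_ne' hk]) (by simp)]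
    simp [Pi.single_apply]
  have h3 : ((d, Z) : (Fin m ⊕ Fin n → ℂ) × (Fin m → Fin n → ℂ)) =
      ∑ s, d s • (Pi.single s (1 : ℂ), (0 : Fin m → Fin n → ℂ)) +
      ∑ i, ∑ j, Z i j • ((0 : Fin m ⊕ Fin n → ℂ), Pi.single i (Pi.single j (1 : ℂ))) := by
    refine Prod.ext ?_ ?_
    · simpa [Prod.fst_sum] using h1
    · simpa [Prod.snd_sum] using h2
  have h4 := congrArg f h3
  simp only [map_add, map_sum, map_smul, smul_eq_mul] at h4
  rw [h4]
  simp only [mul_comm]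

/-- If the all-ones diagonal together with the block `X` comes from a positive matrix `C^*C`, the
columns of `C` split into `L` and `R`. Otherwise a separating functional contradicts the dual
estimate. -/
theorem exists_factorization_of_schurNorm_le_one {X : Matrix (Fin m) (Fin n) ℂ}
    (hX : schurNorm X ≤ 1) :
    ∃ (L : Matrix (Fin m ⊕ Fin n) (Fin m) ℂ) (R : Matrix (Fin m ⊕ Fin n) (Fin n) ℂ),
      ColsLeOne L ∧ ColsLeOne R ∧ X = L.conjTranspose * R := by
  by_cases hmem : ((fun _ => 1, X) : (Fin m ⊕ Fin n → ℂ) × (Fin m → Fin n → ℂ)) ∈ gramCone m n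
  · obtain ⟨A, hA, hAX⟩ := hmem
    obtain ⟨C, rfl⟩ := exists_conjTranspose_mul_self hA
    have hd : ∀ s, ∑ k, ‖C k s‖ ^ 2 = 1 := fun s => by
      have h1 : (C.conjTranspose * C) s s = 1 := congrFun (congrArg Prod.fst hAX) s
      have h2 := conjTranspose_mul_self_apply_self C s
      exact_mod_cast h2.symm.trans h1
    refine ⟨C.submatrix id Sum.inl, C.submatrix id Sum.inr, fun i => (hd _).le,
      fun j => (hd _).le, ?_⟩
    ext i j
    exact (congrFun (congrFun (congrArg Prod.snd hAX) i) j).symm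
  · exfalso
    obtain ⟨f, u, hfx, hfu⟩ := RCLike.geometric_hahn_banach_point_closed (𝕜 := ℂ)
      convex_gramCone isClosed_gramCone hmem
    have hu : u < 0 := by simpa using hfu 0 ⟨0, Matrix.PosSemidef.zero, map_zero _⟩
    have hnonneg : ∀ A : Matrix (Fin m ⊕ Fin n) (Fin m ⊕ Fin n) ℂ, A.PosSemidef →
        0 ≤ (f (gramData m n A)).re := by
      intro A hA
      by_contra! hneg
      -- A functional bounded below on a cone is nonnegative there: scaling by `u / a` would produce
      -- the forbidden value `u`.
      set a := (f (gramData m n A)).re with ha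
      have ht : 0 ≤ u / a := (div_pos_of_neg_of_neg hu hneg).le
      have := hfu _ ⟨(u / a) • A, hA.smul ht, rfl⟩
      rw [LinearMap.map_smul_of_tower, ContinuousLinearMap.map_smul_of_tower] at this
      simp only [RCLike.re_eq_complex_re, Complex.smul_re, ← ha, smul_eq_mul] at this
      rw [div_mul_cancel₀ _ hneg.ne] at this
      exact lt_irrefl _ this
    obtain ⟨c, b, hf⟩ := linearMap_apply_eq_sum f.toLinearMap
    replace hf : ∀ z, f z = ∑ s, c s * z.1 s + ∑ i, ∑ j, b i j * z.2 i j := hf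
    -- Positivity on the rank-one matrices `ww^*` is the domination hypothesis of
    -- `neg_sum_le_re_pairing`, with weights `Re c`.
    have hrank1 : ∀ w : Fin m ⊕ Fin n → ℂ, 0 ≤ ∑ s, (c s).re * ‖w s‖ ^ 2 +
        (∑ i, ∑ j, b i j * (w (Sum.inl i) * star (w (Sum.inr j)))).re := by
      intro w
      have := hnonneg _ (Matrix.posSemidef_vecMulVec_self_star w)
      rw [hf, Complex.add_re] at this
      refine this.trans_eq (congrArg₂ (· + ·) ?_ rfl)
      rw [Complex.re_sum]
      refine Finset.sum_congr rfl fun s _ => ?_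
      have h1 : w s * star (w s) = ((‖w s‖ ^ 2 : ℝ) : ℂ) := by
        rw [RCLike.star_def, Complex.mul_conj']; push_cast; rfl
      change (c s * (w s * star (w s))).re = _
      rw [h1, Complex.re_mul_ofReal]
    have hc : ∀ s, 0 ≤ (c s).re := by
      intro s
      have := hrank1 (Pi.single s 1)
      rw [Finset.sum_eq_single s (fun t _ ht => by simp [Pi.single_eq_of_ne ht]) (by simp)] at this
      rcases s with s | s <;> simpa using this
    have hx : ∑ s, (c s).re + (∑ i, ∑ j, b i j * X i j).re < 0 := by
      have := hfx.trans hu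
      rw [hf, RCLike.re_eq_complex_re, Complex.add_re, Complex.re_sum] at this
      simpa using this
    set δ := -(∑ s, (c s).re + (∑ i, ∑ j, b i j * X i j).re) with hδ
    -- The weights `Re c` may vanish, so each is raised by `ε`. The total increase `(m + n)ε` stays
    -- below the gap `δ` because of the extra 1.
    set ε := δ / (m + n + 1) with hε
    have hεpos : 0 < ε := div_pos (by linarith) (by positivity)
    have hmn : ε * (m + n + 1) = δ := by rw [hε]; field_simp
    have := neg_sum_le_re_pairing hX (p := fun i => (c (Sum.inl i)).re + ε)
      (q := fun j => (c (Sum.inr j)).re + ε) (fun i => by linarith [hc (Sum.inl i)])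
      (fun j => by linarith [hc (Sum.inr j)]) (b := b) (fun x y => by
        refine (hrank1 (Sum.elim x y)).trans ?_
        rw [Fintype.sum_sum_type]
        simp only [Sum.elim_inl, Sum.elim_inr]
        gcongr <;> linarith)
    rw [Fintype.sum_sum_type] at hδ
    simp only [Finset.sum_add_distrib, Finset.sum_const, Finset.card_univ, Fintype.card_fin,
      nsmul_eq_mul] at this
    nlinarith

end GramCone

end SchurMult

namespace SchurMult

/-! ### Reducing the inner dimension to the rank. -/

section Rank

variable {m n r : ℕ}

lemma isUnit_of_rank_eq {A : Matrix (Fin r) (Fin r) ℂ} (hA : A.rank = r) : IsUnit A := by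
  rw [← Matrix.mulVec_surjective_iff_isUnit]
  have : LinearMap.range A.mulVecLin = ⊤ := by
    apply Submodule.eq_top_of_finrank_eq
    rw [Module.finrank_fin_fun]; exact hA
  exact LinearMap.range_eq_top.1 this

lemma isUnit_mul_conjTranspose_of_injective {L : Matrix (Fin r) (Fin m) ℂ}
    (h : ∀ v, L.conjTranspose.mulVec v = 0 → v = 0) : IsUnit (L * L.conjTranspose) := by
  rw [← Matrix.mulVec_injective_iff_isUnit]
  refine (injective_iff_map_eq_zero (L * L.conjTranspose).mulVecLin).2 fun v hv => h v ?_
  exact (Matrix.self_mul_conjTranspose_mulVec_eq_zero L v).1 hv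

/-- Multiplying by `L` on the left and `R^*` on the right turns `L^*R` into a product of two
invertible Gram matrices. -/
lemma rank_mul_of_isUnit {L : Matrix (Fin r) (Fin m) ℂ} {R : Matrix (Fin r) (Fin n) ℂ}
    (hL : IsUnit (L * L.conjTranspose)) (hR : IsUnit (R * R.conjTranspose)) :
    (L.conjTranspose * R).rank = r := by
  refine le_antisymm ((Matrix.rank_mul_le_right _ _).trans (Matrix.rank_le_height R)) ?_
  have h := Matrix.rank_of_isUnit _ (hL.mul hR)
  have e : L * L.conjTranspose * (R * R.conjTranspose) =
      L * ((L.conjTranspose * R) * R.conjTranspose) := by simp only [Matrix.mul_assoc]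
  rw [e, Fintype.card_fin] at h
  calc r = _ := h.symm
    _ ≤ _ := Matrix.rank_mul_le_right _ _
    _ ≤ _ := Matrix.rank_mul_le_left _ _

lemma isUnit_of_rank_mul_eq {L : Matrix (Fin r) (Fin m) ℂ} {R : Matrix (Fin r) (Fin n) ℂ}
    (h : (L.conjTranspose * R).rank = r) :
    IsUnit (L * L.conjTranspose) ∧ IsUnit (R * R.conjTranspose) := by
  constructor <;> apply isUnit_of_rank_eq <;> rw [Matrix.rank_self_mul_conjTranspose] <;>
    refine le_antisymm (Matrix.rank_le_height _) ?_
  · conv_lhs => rw [← h]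
    exact (Matrix.rank_mul_le_left _ _).trans_eq (Matrix.rank_conjTranspose L)
  · conv_lhs => rw [← h]
    exact Matrix.rank_mul_le_right _ _

lemma mem_orthogonal_span_range {H ι : Type*} [NormedAddCommGroup H] [InnerProductSpace ℂ H]
    {w : ι → H} {x : H} (hx : ∀ i, inner ℂ (w i) x = 0) :
    x ∈ (Submodule.span ℂ (Set.range w))ᗮ := by
  rw [Submodule.mem_orthogonal]
  intro u hu
  induction hu using Submodule.span_induction with
  | mem u hu => obtain ⟨i, rfl⟩ := hu; exact hx i
  | zero => simp
  | add u w _ _ hu hw => rw [inner_add_left, hu, hw, add_zero]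
  | smul c u _ hu => rw [inner_smul_left, hu, mul_zero]

/-- The products `⟨lᵢ, sⱼ⟩` see only the projections of the `lᵢ` to the span `E₁` of the `sⱼ`, and
then only the projections of the `sⱼ` to the span `E` of those. Projecting lengthens no column, and
both families end up spanning `E`, so `dim E` equals the rank. -/
theorem exists_rank_factorization {κ : Type*} [Fintype κ] {X : Matrix (Fin m) (Fin n) ℂ}
    {L : Matrix κ (Fin m) ℂ} {R : Matrix κ (Fin n) ℂ} (hL : ColsLeOne L) (hR : ColsLeOne R)
    (hX : X = L.conjTranspose * R) (hr : X.rank = r) :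
    ∃ (L' : Matrix (Fin r) (Fin m) ℂ) (R' : Matrix (Fin r) (Fin n) ℂ),
      ColsLeOne L' ∧ ColsLeOne R' ∧ X = L'.conjTranspose * R' := by
  let l : Fin m → EuclideanSpace ℂ κ := fun i => WithLp.toLp 2 fun k => L k i
  let s : Fin n → EuclideanSpace ℂ κ := fun j => WithLp.toLp 2 fun k => R k j
  have hXls : ∀ i j, X i j = inner ℂ (l i) (s j) := fun i j => by
    rw [hX, Matrix.mul_apply]
    simp [l, s, PiLp.inner_apply, mul_comm]
  have hl : ∀ i, ‖l i‖ ≤ 1 := fun i => by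
    rw [← sq_le_one_iff₀ (norm_nonneg _), EuclideanSpace.norm_sq_eq]
    exact hL i
  have hs : ∀ j, ‖s j‖ ≤ 1 := fun j => by
    rw [← sq_le_one_iff₀ (norm_nonneg _), EuclideanSpace.norm_sq_eq]
    exact hR j
  let E₁ : Submodule ℂ (EuclideanSpace ℂ κ) := Submodule.span ℂ (Set.range s)
  let l' : Fin m → EuclideanSpace ℂ κ := fun i => E₁.starProjection (l i)
  let E : Submodule ℂ (EuclideanSpace ℂ κ) := Submodule.span ℂ (Set.range l')
  have hEE₁ : E ≤ E₁ := Submodule.span_le.2 (by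
    rintro _ ⟨i, rfl⟩; exact E₁.starProjection_apply_mem _)
  let lE : Fin m → E := fun i => ⟨l' i, Submodule.subset_span ⟨i, rfl⟩⟩
  let sE : Fin n → E := fun j => E.orthogonalProjectionOnto (s j)
  let e := stdOrthonormalBasis ℂ E
  have hsE : ∀ j (x : E), inner ℂ (sE j) x = inner ℂ (s j) (x : EuclideanSpace ℂ κ) := fun j x => by
    exact Submodule.inner_orthogonalProjectionOnto_eq_of_mem_right x (s j)
  have hin : ∀ i j, inner ℂ (lE i) (sE j) = X i j := fun i j => by
    have h1 : inner ℂ (lE i) (sE j) = inner ℂ (l' i) (s j) :=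
      Submodule.inner_orthogonalProjectionOnto_eq_of_mem_left (lE i) (s j)
    rw [h1, hXls, Submodule.inner_starProjection_left_eq_right,
      Submodule.starProjection_eq_self_iff.2 (Submodule.subset_span (Set.mem_range_self j))]
  let L' : Matrix (Fin (Module.finrank ℂ E)) (Fin m) ℂ := Matrix.of fun k i => e.repr (lE i) k
  let R' : Matrix (Fin (Module.finrank ℂ E)) (Fin n) ℂ := Matrix.of fun k j => e.repr (sE j) k
  have hmul : ∀ (x : E) (y : E), ∑ k, star (e.repr x k) * e.repr y k = inner ℂ x y := fun x y => by
    rw [← e.repr.inner_map_map x y, PiLp.inner_apply]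
    simp [mul_comm]
  have hLR : X = L'.conjTranspose * R' := by
    ext i j
    rw [← hin, ← hmul]; rfl
  have hL' : ColsLeOne L' := fun i => by
    have h1 : ‖e.repr (lE i)‖ ≤ 1 := by
      rw [e.repr.norm_map]
      exact (E₁.norm_starProjection_apply_le (l i)).trans (hl i)
    rw [← sq_le_one_iff₀ (norm_nonneg _), EuclideanSpace.norm_sq_eq] at h1
    exact h1
  have hR' : ColsLeOne R' := fun j => by
    have h1 : ‖e.repr (sE j)‖ ≤ 1 := by
      rw [e.repr.norm_map]
      exact (E.norm_orthogonalProjectionOnto_apply_le (s j)).trans (hs j)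
    rw [← sq_le_one_iff₀ (norm_nonneg _), EuclideanSpace.norm_sq_eq] at h1
    exact h1
  have uL : IsUnit (L' * L'.conjTranspose) := by
    refine isUnit_mul_conjTranspose_of_injective fun v hv => ?_
    let x := e.repr.symm (WithLp.toLp 2 v)
    have hx : ∀ i, inner ℂ (l' i) (x : EuclideanSpace ℂ κ) = 0 := fun i => by
      have h1 := congrFun hv i
      have h2 := hmul (lE i) x
      simp only [x, LinearIsometryEquiv.apply_symm_apply] at h2
      exact h2.symm.trans h1
    have hx0 : (x : EuclideanSpace ℂ κ) ∈ Eᗮ := mem_orthogonal_span_range hx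
    have hx1 : x = 0 := Subtype.ext (inner_self_eq_zero.1 (hx0 x x.2))
    have := congrArg e.repr hx1
    simp only [x, LinearIsometryEquiv.apply_symm_apply, map_zero] at this
    exact congrArg WithLp.ofLp this
  have uR : IsUnit (R' * R'.conjTranspose) := by
    refine isUnit_mul_conjTranspose_of_injective fun v hv => ?_
    let x := e.repr.symm (WithLp.toLp 2 v)
    have hx : ∀ j, inner ℂ (s j) (x : EuclideanSpace ℂ κ) = 0 := fun j => by
      have h1 := congrFun hv j
      have h2 := hmul (sE j) x
      simp only [x, LinearIsometryEquiv.apply_symm_apply] at h2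
      exact (hsE j x).symm.trans (h2.symm.trans h1)
    -- Since `E ≤ E₁`, a vector of `E` orthogonal to all `sⱼ` is zero.
    have hx0 : (x : EuclideanSpace ℂ κ) ∈ E₁ᗮ := mem_orthogonal_span_range hx
    have hx1 : x = 0 := Subtype.ext (inner_self_eq_zero.1 (hx0 x (hEE₁ x.2)))
    have := congrArg e.repr hx1
    simp only [x, LinearIsometryEquiv.apply_symm_apply, map_zero] at this
    exact congrArg WithLp.ofLp this
  have hd : Module.finrank ℂ E = r := by
    rw [← hr, hLR, rank_mul_of_isUnit uL uR]
  -- Generalizing the factors lets `finrank ℂ E` be replaced by `r` in their types.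
  clear_value L' R'
  revert L' R'
  rw [hd]
  intro L' R' h1 h2 h3 _ _
  exact ⟨L', R', h2, h3, h1⟩

end Rank

end SchurMult

namespace SchurMult

/-! ### Consequences of extremality. -/

section Extreme

variable {m n r : ℕ}

lemma eq_zero_of_add_sub_mem {E : Type*} [AddCommGroup E] [Module ℝ E] {s : Set E} {x d : E}
    (hx : x ∈ s.extremePoints ℝ) (h₁ : x + d ∈ s) (h₂ : x - d ∈ s) : d = 0 := by
  have h := (mem_extremePoints_iff_left.1 hx).2 _ h₁ _ h₂
    ⟨1 / 2, 1 / 2, by norm_num, by norm_num, by norm_num, by module⟩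
  simpa using h

open scoped Matrix.Norms.L2Operator in
lemma ne_zero_of_schurNorm_eq_one {X : Matrix (Fin m) (Fin n) ℂ} (h : schurNorm X = 1) :
    X ≠ 0 := by
  rintro rfl
  have : schurMultiplier (0 : Matrix (Fin m) (Fin n) ℂ) = 0 := by
    ext Y i j; simp [schurMultiplier]
  rw [schurNorm, this, map_zero] at h
  exact zero_ne_one (ContinuousLinearMap.opNorm_zero.symm.trans h)

lemma colsLeOne_iff {L : Matrix (Fin r) (Fin m) ℂ} : ColsLeOne L ↔ ∀ i, ‖colVec L i‖ ≤ 1 :=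
  forall_congr' fun i => by rw [← norm_colVec_sq, sq_le_one_iff₀ (norm_nonneg _)]

/-- By the triangle inequality, one entry of a short column may move by the slack `1 - ‖colVec L i‖`
in either direction. -/
lemma exists_perturbation {L : Matrix (Fin r) (Fin m) ℂ} (hL : ColsLeOne L) {i : Fin m}
    (hi : ‖colVec L i‖ ≠ 1) (k : Fin r) :
    ∃ t : ℝ, t ≠ 0 ∧ ColsLeOne (L + Matrix.single k i (t : ℂ)) ∧
      ColsLeOne (L - Matrix.single k i (t : ℂ)) := by
  rw [colsLeOne_iff] at hL
  have hlt : ‖colVec L i‖ < 1 := (hL i).lt_of_ne hi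
  have hcol : ∀ t : ℝ, |t| = 1 - ‖colVec L i‖ → ColsLeOne (L + Matrix.single k i (t : ℂ)) := by
    intro t ht
    rw [colsLeOne_iff]
    intro j
    by_cases hj : j = i
    · subst hj
      have : colVec (L + Matrix.single k j (t : ℂ)) j =
          colVec L j + EuclideanSpace.single k (t : ℂ) := by
        ext l
        simp [colVec, Matrix.single_apply, eq_comm]
      rw [this]
      refine (norm_add_le _ _).trans ?_
      simp [ht]
    · have : colVec (L + Matrix.single k i (t : ℂ)) j = colVec L j := by
        ext l
        simp [colVec, Ne.symm hj]
      rw [this]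
      exact hL j
  refine ⟨1 - ‖colVec L i‖, by linarith, hcol _ (abs_of_pos (by linarith)), ?_⟩
  have := hcol (-(1 - ‖colVec L i‖)) (by rw [abs_neg]; exact abs_of_pos (by linarith))
  have hneg : Matrix.single k i ((-(1 - ‖colVec L i‖) : ℝ) : ℂ) =
      -Matrix.single k i ((1 - ‖colVec L i‖ : ℝ) : ℂ) := by
    ext a b
    simp only [Matrix.single_apply, Matrix.neg_apply, Complex.ofReal_neg]
    split_ifs <;> simp
  rwa [hneg, ← sub_eq_add_neg] at this

/-- If column `i` of `L` is short, moving its entry `k` by `±t` changes row `i` of `X` by `±t` times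
row `k` of `R`. Extremality kills that row for every `k`, so `R = 0`. The case of `R` is symmetric.
-/
theorem norm_colVec_eq_one {X : Matrix (Fin m) (Fin n) ℂ}
    (hext : X ∈ Set.extremePoints ℝ (schurUnitBall m n)) (hX : X ≠ 0)
    {L : Matrix (Fin r) (Fin m) ℂ} {R : Matrix (Fin r) (Fin n) ℂ}
    (hL : ColsLeOne L) (hR : ColsLeOne R) (h : X = L.conjTranspose * R) :
    (∀ i, ‖colVec L i‖ = 1) ∧ ∀ j, ‖colVec R j‖ = 1 := by
  constructor
  · intro i
    by_contra hi
    refine hX ?_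
    suffices R = 0 by rw [h, this, Matrix.mul_zero]
    ext k j
    obtain ⟨t, ht, h₁, h₂⟩ := exists_perturbation hL hi k
    have hD := eq_zero_of_add_sub_mem (d := (Matrix.single k i (t : ℂ)).conjTranspose * R) hext
      (by rw [h, ← Matrix.add_mul, ← Matrix.conjTranspose_add]; exact schurNorm_mul_le_one h₁ hR)
      (by rw [h, ← Matrix.sub_mul, ← Matrix.conjTranspose_sub]; exact schurNorm_mul_le_one h₂ hR)
    have := congrFun (congrFun hD i) j
    rw [Matrix.conjTranspose_single, Matrix.single_mul_apply_same] at this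
    simpa [ht] using this
  · intro j
    by_contra hj
    refine hX ?_
    suffices L = 0 by rw [h, this, Matrix.conjTranspose_zero, Matrix.zero_mul]
    ext k i
    obtain ⟨t, ht, h₁, h₂⟩ := exists_perturbation hR hj k
    have hD := eq_zero_of_add_sub_mem (d := L.conjTranspose * Matrix.single k j (t : ℂ)) hext
      (by rw [h, ← Matrix.mul_add]; exact schurNorm_mul_le_one hL h₁)
      (by rw [h, ← Matrix.mul_sub]; exact schurNorm_mul_le_one hL h₂)
    have := congrFun (congrFun hD i) j
    rw [Matrix.mul_single_apply_same] at this
    simpa [ht] using this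

open scoped MatrixOrder Matrix.Norms.L2Operator in
-- A Hermitian matrix is at most its norm times the identity. The scale `(‖Y‖ + 1)⁻¹` remains
-- nonzero when `Y = 0`.
lemma exists_posSemidef_one_add_sub {Y : Matrix (Fin r) (Fin r) ℂ} (hY : Y.IsHermitian) :
    ∃ t : ℝ, t ≠ 0 ∧ (1 + t • Y).PosSemidef ∧ (1 - t • Y).PosSemidef := by
  have hc : 0 < ‖Y‖ + 1 := by positivity
  have key : ∀ Z : Matrix (Fin r) (Fin r) ℂ, Z.IsHermitian → ‖Z‖ = ‖Y‖ →
      (1 - (‖Y‖ + 1)⁻¹ • Z).PosSemidef := by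
    intro Z hZ hn
    have h1 := Matrix.le_iff.1 (IsSelfAdjoint.le_algebraMap_norm_self (a := Z) hZ)
    rw [hn, Algebra.algebraMap_eq_smul_one] at h1
    have h2 := (h1.add Matrix.PosSemidef.one).smul (inv_nonneg.2 hc.le)
    have h3 : (‖Y‖ + 1)⁻¹ * ‖Y‖ = 1 - (‖Y‖ + 1)⁻¹ := by field_simp; ring
    have h4 : (1 : Matrix (Fin r) (Fin r) ℂ) - (‖Y‖ + 1)⁻¹ • Z =
        (‖Y‖ + 1)⁻¹ • (‖Y‖ • 1 - Z + 1) := by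
      rw [smul_add, smul_sub, smul_smul, h3]
      module
    rw [h4]
    exact h2
  refine ⟨(‖Y‖ + 1)⁻¹, (inv_pos.2 hc).ne', ?_, key Y hY rfl⟩
  have := key (-Y) hY.neg (norm_neg Y)
  rwa [smul_neg, sub_neg_eq_add] at this

lemma colsLeOne_mul {C A : Matrix (Fin r) (Fin r) ℂ} (hC : A = C.conjTranspose * C)
    {L : Matrix (Fin r) (Fin m) ℂ} (hA : ∀ i, (L.conjTranspose * A * L) i i = 1) :
    ColsLeOne (C * L) := fun i => by
  have h1 := conjTranspose_mul_self_apply_self (C * L) i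
  have h2 : (C * L).conjTranspose * (C * L) = L.conjTranspose * A * L := by
    rw [hC, Matrix.conjTranspose_mul]; simp only [Matrix.mul_assoc]
  rw [h2, hA] at h1
  exact le_of_eq (by exact_mod_cast h1.symm)

/-- With `A = C^*C` the matrix is `(CL)^*(CR)`, and the diagonal conditions say that these factors
have unit columns. -/
lemma schurNorm_sandwich_le_one {A : Matrix (Fin r) (Fin r) ℂ} (hA : A.PosSemidef)
    {L : Matrix (Fin r) (Fin m) ℂ} {R : Matrix (Fin r) (Fin n) ℂ}
    (hL : ∀ i, (L.conjTranspose * A * L) i i = 1) (hR : ∀ j, (R.conjTranspose * A * R) j j = 1) :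
    schurNorm (L.conjTranspose * A * R) ≤ 1 := by
  obtain ⟨C, hC⟩ := exists_conjTranspose_mul_self hA
  have h := schurNorm_mul_le_one (colsLeOne_mul hC hL) (colsLeOne_mul hC hR)
  rwa [Matrix.conjTranspose_mul, Matrix.mul_assoc, ← Matrix.mul_assoc _ C R, ← hC,
    ← Matrix.mul_assoc] at h

lemma conjTranspose_mul_self_apply_of_unit {L : Matrix (Fin r) (Fin m) ℂ} {i : Fin m}
    (h : ‖colVec L i‖ = 1) : (L.conjTranspose * L) i i = 1 := by
  rw [conjTranspose_mul_self_apply_self, ← norm_colVec_sq, h]; simp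

variable {X : Matrix (Fin m) (Fin n) ℂ} {L : Matrix (Fin r) (Fin m) ℂ}
  {R : Matrix (Fin r) (Fin n) ℂ}

lemma eq_zero_of_isHermitian (hext : X ∈ Set.extremePoints ℝ (schurUnitBall m n))
    (hrank : X.rank = r) (h : X = L.conjTranspose * R)
    (hL : ∀ i, ‖colVec L i‖ = 1) (hR : ∀ j, ‖colVec R j‖ = 1)
    {Y : Matrix (Fin r) (Fin r) ℂ} (hY : Y.IsHermitian)
    (hYL : ∀ i, (L.conjTranspose * Y * L) i i = 0)
    (hYR : ∀ j, (R.conjTranspose * Y * R) j j = 0) : Y = 0 := by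
  obtain ⟨t, ht, h₁, h₂⟩ := exists_posSemidef_one_add_sub hY
  have ndL := fun i => conjTranspose_mul_self_apply_of_unit (hL i)
  have ndR := fun j => conjTranspose_mul_self_apply_of_unit (hR j)
  have hD := eq_zero_of_add_sub_mem (d := t • (L.conjTranspose * Y * R)) hext
    (by
      change schurNorm _ ≤ 1
      have := schurNorm_sandwich_le_one h₁ (L := L) (R := R)
        (fun i => by simp [Matrix.mul_add, Matrix.add_mul, hYL, ndL])
        (fun i => by simp [Matrix.mul_add, Matrix.add_mul, hYR, ndR])
      simpa [Matrix.mul_add, Matrix.add_mul, ← h] using this)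
    (by
      change schurNorm _ ≤ 1
      have := schurNorm_sandwich_le_one h₂ (L := L) (R := R)
        (fun i => by simp [Matrix.mul_sub, Matrix.sub_mul, hYL, ndL])
        (fun i => by simp [Matrix.mul_sub, Matrix.sub_mul, hYR, ndR])
      simpa [Matrix.mul_sub, Matrix.sub_mul, ← h] using this)
  have h0 := (smul_eq_zero.1 hD).resolve_left ht
  obtain ⟨uL, uR⟩ := isUnit_of_rank_mul_eq (L := L) (R := R) (by rw [← h, hrank])
  -- Full rank makes both Gram matrices invertible, so `L^*YR = 0` can be cancelled down to `Y = 0`.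
  have h1 : L * L.conjTranspose * (Y * (R * R.conjTranspose)) = 0 := by
    have : L * L.conjTranspose * (Y * (R * R.conjTranspose)) =
        L * (L.conjTranspose * Y * R) * R.conjTranspose := by simp only [Matrix.mul_assoc]
    rw [this, h0, Matrix.mul_zero, Matrix.zero_mul]
  exact uR.mul_left_eq_zero.1 (uL.mul_right_eq_zero.1 h1)

lemma conjTranspose_sandwich_diag_eq_zero {Y : Matrix (Fin r) (Fin r) ℂ}
    (hY : ∀ i, (L.conjTranspose * Y * L) i i = 0) (i : Fin m) :
    (L.conjTranspose * Y.conjTranspose * L) i i = 0 := by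
  have : L.conjTranspose * Y.conjTranspose * L = (L.conjTranspose * Y * L).conjTranspose := by
    simp [Matrix.conjTranspose_mul, Matrix.mul_assoc]
  rw [this, Matrix.conjTranspose_apply, hY, star_zero]

/-- The diagonal conditions are stable under adjoints, so the Hermitian case applies to `Y + Y^*`
and to `i(Y - Y^*)`. -/
theorem eq_zero_of_sandwich_diag_eq_zero (hext : X ∈ Set.extremePoints ℝ (schurUnitBall m n))
    (hrank : X.rank = r) (h : X = L.conjTranspose * R)
    (hL : ∀ i, ‖colVec L i‖ = 1) (hR : ∀ j, ‖colVec R j‖ = 1)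
    {Y : Matrix (Fin r) (Fin r) ℂ} (hYL : ∀ i, (L.conjTranspose * Y * L) i i = 0)
    (hYR : ∀ j, (R.conjTranspose * Y * R) j j = 0) : Y = 0 := by
  have hYL' := conjTranspose_sandwich_diag_eq_zero hYL
  have hYR' := conjTranspose_sandwich_diag_eq_zero hYR
  have h1 : Y + Y.conjTranspose = 0 := eq_zero_of_isHermitian hext hrank h hL hR
    (Matrix.isHermitian_add_transpose_self Y)
    (fun i => by simp [Matrix.mul_add, Matrix.add_mul, hYL, hYL'])
    (fun i => by simp [Matrix.mul_add, Matrix.add_mul, hYR, hYR'])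
  have h2 : Complex.I • (Y - Y.conjTranspose) = 0 := eq_zero_of_isHermitian hext hrank h hL hR
    (by
      rw [Matrix.IsHermitian, Matrix.conjTranspose_smul, Matrix.conjTranspose_sub,
        Matrix.conjTranspose_conjTranspose, RCLike.star_def, Complex.conj_I]
      module)
    (fun i => by simp [Matrix.mul_sub, Matrix.sub_mul, hYL, hYL'])
    (fun i => by simp [Matrix.mul_sub, Matrix.sub_mul, hYR, hYR'])
  have h3 := (smul_eq_zero.1 h2).resolve_left Complex.I_ne_zero
  have h4 : (2 : ℂ) • Y = 0 := by
    have : (2 : ℂ) • Y = (Y + Y.conjTranspose) + (Y - Y.conjTranspose) := by module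
    rw [this, h1, h3, add_zero]
  exact (smul_eq_zero.1 h4).resolve_left two_ne_zero

lemma vectorFunctional_colVec (L : Matrix (Fin r) (Fin m) ℂ) (Y : Matrix (Fin r) (Fin r) ℂ)
    (i : Fin m) : vectorFunctional (colVec L i) Y = (L.conjTranspose * Y * L) i i := by
  rw [Matrix.mul_assoc, Matrix.mul_apply, vectorFunctional, PiLp.inner_apply]
  refine Finset.sum_congr rfl fun k _ => ?_
  rw [RCLike.inner_apply, mul_comm]
  rfl

theorem isFullSet_cols (hext : X ∈ Set.extremePoints ℝ (schurUnitBall m n))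
    (hrank : X.rank = r) (h : X = L.conjTranspose * R)
    (hL : ∀ i, ‖colVec L i‖ = 1) (hR : ∀ j, ‖colVec R j‖ = 1) :
    IsFullSet (Set.range (colVec L) ∪ Set.range (colVec R)) := by
  intro Y _ hY
  refine eq_zero_of_sandwich_diag_eq_zero hext hrank h hL hR (fun i => ?_) fun j => ?_
  · rw [← vectorFunctional_colVec]; exact hY _ (Or.inl ⟨i, rfl⟩)
  · rw [← vectorFunctional_colVec]; exact hY _ (Or.inr ⟨j, rfl⟩)

theorem sq_le_of_extreme (hext : X ∈ Set.extremePoints ℝ (schurUnitBall m n))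
    (hrank : X.rank = r) (h : X = L.conjTranspose * R)
    (hL : ∀ i, ‖colVec L i‖ = 1) (hR : ∀ j, ‖colVec R j‖ = 1) : r ^ 2 ≤ m + n := by
  let T : Matrix (Fin r) (Fin r) ℂ →ₗ[ℂ] (Fin m → ℂ) × (Fin n → ℂ) :=
    { toFun := fun Y => (fun i => (L.conjTranspose * Y * L) i i,
        fun j => (R.conjTranspose * Y * R) j j)
      map_add' := fun Y Z => by
        ext <;> simp [Matrix.mul_add, Matrix.add_mul]
      map_smul' := fun c Y => by
        ext <;> simp }
  have hT : Function.Injective T := (injective_iff_map_eq_zero T).2 fun Y hY =>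
    eq_zero_of_sandwich_diag_eq_zero hext hrank h hL hR
      (fun i => congrFun (congrArg Prod.fst hY) i) (fun j => congrFun (congrArg Prod.snd hY) j)
  have := LinearMap.finrank_le_finrank_of_injective hT
  simpa [Module.finrank_matrix, sq] using this

end Extreme

/-! ### Polar decomposition of the factors. -/

section Polar

variable {m n r : ℕ}

open scoped MatrixOrder in
-- Take `S = (LL^*)^(-1/2)`, `U = SL` and `F = L^*SL`, which is the absolute value of `L`.
-- Everything follows from `S(LL^*)S = 1`.
lemma exists_polar {L : Matrix (Fin r) (Fin m) ℂ} (hL : IsUnit (L * L.conjTranspose)) :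
    ∃ (U : Matrix (Fin r) (Fin m) ℂ) (F : Matrix (Fin m) (Fin m) ℂ),
      U * U.conjTranspose = 1 ∧ U * F = L ∧ F = U.conjTranspose * L ∧ F.PosSemidef ∧
        F ^ 2 = L.conjTranspose * L := by
  set A := L * L.conjTranspose with hA
  have hpos : A.PosSemidef := Matrix.posSemidef_self_mul_conjTranspose L
  have hinv : 0 ≤ A⁻¹ := Matrix.nonneg_iff_posSemidef.2 hpos.inv
  set S := CFC.sqrt A⁻¹ with hS
  have hSS : S * S = A⁻¹ := CFC.sqrt_mul_sqrt_self _ hinv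
  have hSpos : S.PosSemidef := Matrix.nonneg_iff_posSemidef.1 (CFC.sqrt_nonneg _)
  have hSh : S.conjTranspose = S := hSpos.isHermitian
  have hdet : IsUnit A.det := (Matrix.isUnit_iff_isUnit_det A).1 hL
  have hSSA : S * (S * A) = 1 := by
    rw [← Matrix.mul_assoc, hSS, Matrix.nonsing_inv_mul _ hdet]
  have hSAS : S * A * S = 1 := mul_eq_one_comm.1 hSSA
  have hU : (S * L).conjTranspose = L.conjTranspose * S := by rw [Matrix.conjTranspose_mul, hSh]
  have hUF : S * L * (L.conjTranspose * S * L) = L := by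
    have : S * L * (L.conjTranspose * S * L) = S * A * S * L := by
      rw [hA]; simp only [Matrix.mul_assoc]
    rw [this, hSAS, Matrix.one_mul]
  refine ⟨S * L, L.conjTranspose * S * L, ?_, hUF, by rw [hU],
    hSpos.conjTranspose_mul_mul_same L, ?_⟩
  · rw [hU, ← hSAS, hA]; simp only [Matrix.mul_assoc]
  · rw [sq]
    conv_lhs => rw [Matrix.mul_assoc, Matrix.mul_assoc, ← Matrix.mul_assoc S, hUF]

lemma mem_unitDiagPos {L : Matrix (Fin r) (Fin m) ℂ} (hL : ∀ i, ‖colVec L i‖ = 1) :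
    L.conjTranspose * L ∈ unitDiagPos m :=
  ⟨Matrix.posSemidef_conjTranspose_mul_self L,
    fun i => conjTranspose_mul_self_apply_of_unit (hL i)⟩

lemma rank_polar {L U : Matrix (Fin r) (Fin m) ℂ} {F : Matrix (Fin m) (Fin m) ℂ}
    (hL : IsUnit (L * L.conjTranspose)) (hU : U * F = L) (hF : F = U.conjTranspose * L) :
    F.rank = r := by
  have hr : L.rank = r := by
    rw [← Matrix.rank_self_mul_conjTranspose, Matrix.rank_of_isUnit _ hL, Fintype.card_fin]
  refine le_antisymm ?_ ?_
  · rw [hF]; exact (Matrix.rank_mul_le_right _ _).trans_eq hr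
  · conv_lhs => rw [← hr, ← hU]
    exact Matrix.rank_mul_le_right _ _

lemma toEuclideanLin_mul_apply {a b c : ℕ} (A : Matrix (Fin a) (Fin b) ℂ)
    (B : Matrix (Fin b) (Fin c) ℂ) (x : EuclideanSpace ℂ (Fin c)) :
    Matrix.toEuclideanLin (A * B) x = Matrix.toEuclideanLin A (Matrix.toEuclideanLin B x) := by
  simp [Matrix.toLpLin_apply, Matrix.mulVec_mulVec]

lemma inner_toEuclideanLin_conjTranspose {a b : ℕ} (A : Matrix (Fin a) (Fin b) ℂ)
    (x : EuclideanSpace ℂ (Fin a)) (y : EuclideanSpace ℂ (Fin b)) :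
    inner ℂ (Matrix.toEuclideanLin A.conjTranspose x) y =
      inner ℂ x (Matrix.toEuclideanLin A y) := by
  rw [Matrix.toEuclideanLin_conjTranspose_eq_adjoint, LinearMap.adjoint_inner_left]

lemma norm_conjTranspose_of_coisometry {U : Matrix (Fin r) (Fin m) ℂ}
    (hU : U * U.conjTranspose = 1) (x : EuclideanSpace ℂ (Fin r)) :
    ‖Matrix.toEuclideanLin U.conjTranspose x‖ = ‖x‖ := by
  have h : (inner ℂ (Matrix.toEuclideanLin U.conjTranspose x)
      (Matrix.toEuclideanLin U.conjTranspose x) : ℂ) = inner ℂ x x := by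
    rw [inner_toEuclideanLin_conjTranspose, ← toEuclideanLin_mul_apply, hU]
    simp
  rw [inner_self_eq_norm_sq_to_K, inner_self_eq_norm_sq_to_K] at h
  exact (sq_eq_sq₀ (norm_nonneg _) (norm_nonneg _)).1 (by exact_mod_cast h)

/-- `L` has the right inverse `L^*(LL^*)⁻¹`, so composing `U^*` with it loses no range. -/
lemma matRange_polar {L U : Matrix (Fin r) (Fin m) ℂ} {F : Matrix (Fin m) (Fin m) ℂ}
    (hL : IsUnit (L * L.conjTranspose)) (hF : F = U.conjTranspose * L) :
    matRange F = matRange U.conjTranspose := by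
  apply le_antisymm
  · rintro _ ⟨x, rfl⟩
    exact ⟨Matrix.toEuclideanLin L x, by rw [← toEuclideanLin_mul_apply, hF]⟩
  · rintro _ ⟨x, rfl⟩
    have hdet := (Matrix.isUnit_iff_isUnit_det _).1 hL
    refine ⟨Matrix.toEuclideanLin (L.conjTranspose * (L * L.conjTranspose)⁻¹) x, ?_⟩
    rw [← toEuclideanLin_mul_apply, hF, Matrix.mul_assoc, ← Matrix.mul_assoc L,
      Matrix.mul_nonsing_inv _ hdet, Matrix.mul_one]

/-- `W` carries the range of `W^*` isometrically onto `ℂ^r`, and `U^*` carries `ℂ^r` isometrically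
onto its own range. -/
lemma isPartialIsometry_conjTranspose_mul {U : Matrix (Fin r) (Fin m) ℂ}
    {W : Matrix (Fin r) (Fin n) ℂ} (hU : U * U.conjTranspose = 1) (hW : W * W.conjTranspose = 1) :
    IsPartialIsometryFromOnto (U.conjTranspose * W) (matRange W.conjTranspose)
      (matRange U.conjTranspose) := by
  have hV : ∀ x, Matrix.toEuclideanLin (U.conjTranspose * W)
      (Matrix.toEuclideanLin W.conjTranspose x) = Matrix.toEuclideanLin U.conjTranspose x := by
    intro x
    rw [← toEuclideanLin_mul_apply, Matrix.mul_assoc, hW, Matrix.mul_one]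
  refine ⟨?_, ?_, ?_⟩
  · rintro _ ⟨x, rfl⟩
    rw [hV, norm_conjTranspose_of_coisometry hU, norm_conjTranspose_of_coisometry hW]
  · intro x hx
    have h0 : Matrix.toEuclideanLin W x = 0 := by
      have := hx _ ⟨Matrix.toEuclideanLin W x, rfl⟩
      rw [inner_toEuclideanLin_conjTranspose] at this
      exact inner_self_eq_zero.1 this
    rw [toEuclideanLin_mul_apply, h0, map_zero]
  · ext y
    constructor
    · rintro ⟨_, ⟨x, rfl⟩, rfl⟩
      exact ⟨x, (hV x).symm⟩
    · rintro ⟨x, rfl⟩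
      exact ⟨_, ⟨x, rfl⟩, hV x⟩

end Polar

lemma IsSchurFactorization.colsLeOne {m n r : ℕ} {X : Matrix (Fin m) (Fin n) ℂ}
    {L : Matrix (Fin r) (Fin m) ℂ} {R : Matrix (Fin r) (Fin n) ℂ}
    (h : IsSchurFactorization X L R) (hX : schurNorm X = 1) : ColsLeOne L ∧ ColsLeOne R := by
  have key : ∀ {k : ℕ} (A : Matrix (Fin r) (Fin k) ℂ), colNorm A = √(schurNorm X) →
      ColsLeOne A := by
    intro k A hA
    rw [hX, Real.sqrt_one] at hA
    exact colsLeOne_iff.2 fun i =>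
      (le_ciSup (Set.finite_range fun j => ‖colVec A j‖).bddAbove i).trans hA.le
  exact ⟨key L h.colNorm_left, key R h.colNorm_right⟩

end SchurMult

open SchurMult in
theorem mainTheorem1 {m n r : ℕ} (X : Matrix (Fin m) (Fin n) ℂ)
    (hext : X ∈ Set.extremePoints ℝ (SchurMult.schurUnitBall m n))
    (hnorm : SchurMult.schurNorm X = 1) (hrank : X.rank = r) :
    (∀ (L : Matrix (Fin r) (Fin m) ℂ) (R : Matrix (Fin r) (Fin n) ℂ),
      SchurMult.IsSchurFactorization X L R →
        (∀ i, ‖SchurMult.colVec L i‖ = 1) ∧ (∀ j, ‖SchurMult.colVec R j‖ = 1)) ∧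
    (∃ (F : Matrix (Fin m) (Fin m) ℂ) (V : Matrix (Fin m) (Fin n) ℂ)
        (G : Matrix (Fin n) (Fin n) ℂ),
      X = F * V * G ∧
      F.PosSemidef ∧ F.rank = r ∧ F ^ 2 ∈ SchurMult.unitDiagPos m ∧
      G.PosSemidef ∧ G.rank = r ∧ G ^ 2 ∈ SchurMult.unitDiagPos n ∧
      SchurMult.IsPartialIsometryFromOnto V (SchurMult.matRange G) (SchurMult.matRange F)) ∧
    (∀ (L : Matrix (Fin r) (Fin m) ℂ) (R : Matrix (Fin r) (Fin n) ℂ),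
      SchurMult.IsSchurFactorization X L R →
        SchurMult.IsFullSet
          (Set.range (SchurMult.colVec L) ∪ Set.range (SchurMult.colVec R))) ∧
    (X.rank : ℝ) ≤ Real.sqrt ((m : ℝ) + (n : ℝ)) := by
  have hX0 := ne_zero_of_schurNorm_eq_one hnorm
  have hunit : ∀ (L : Matrix (Fin r) (Fin m) ℂ) (R : Matrix (Fin r) (Fin n) ℂ),
      IsSchurFactorization X L R → (∀ i, ‖colVec L i‖ = 1) ∧ (∀ j, ‖colVec R j‖ = 1) :=
    fun L R h => norm_colVec_eq_one hext hX0 (h.colsLeOne hnorm).1 (h.colsLeOne hnorm).2 h.eq_mul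
  -- The polar form and the rank bound need one factorization through `ℂ^r`. Columns of length at
  -- most 1 suffice, since extremality makes them unit vectors.
  obtain ⟨L₀, R₀, hL₀, hR₀, h₀⟩ := exists_factorization_of_schurNorm_le_one hnorm.le
  obtain ⟨L, R, hL, hR, h⟩ := exists_rank_factorization hL₀ hR₀ h₀ hrank
  obtain ⟨nL, nR⟩ := norm_colVec_eq_one hext hX0 hL hR h
  refine ⟨hunit, ?_, fun L R h => isFullSet_cols hext hrank h.eq_mul (hunit L R h).1
    (hunit L R h).2, ?_⟩
  · obtain ⟨uL, uR⟩ := isUnit_of_rank_mul_eq (L := L) (R := R) (by rw [← h, hrank])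
    obtain ⟨U, F, hU, hUF, hF, hFpos, hFsq⟩ := exists_polar uL
    obtain ⟨W, G, hW, hWG, hG, hGpos, hGsq⟩ := exists_polar uR
    refine ⟨F, U.conjTranspose * W, G, ?_, hFpos, rank_polar uL hUF hF,
      hFsq ▸ mem_unitDiagPos nL, hGpos, rank_polar uR hWG hG, hGsq ▸ mem_unitDiagPos nR, ?_⟩
    · have hLF : F * U.conjTranspose = L.conjTranspose := by
        rw [← hUF, Matrix.conjTranspose_mul, hFpos.isHermitian.eq]
      rw [h, ← Matrix.mul_assoc, hLF, Matrix.mul_assoc, hWG]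
    · rw [matRange_polar uL hF, matRange_polar uR hG]
      exact isPartialIsometry_conjTranspose_mul hU hW
  · rw [hrank]
    refine Real.le_sqrt_of_sq_le ?_
    exact_mod_cast sq_le_of_extreme hext hrank h nL nR
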